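/- Let $E\neq 0$ be a complex Banach space and let $L$ be a finite-dimensional solvable complex Lie algebra of bounded linear operators on $E$ acting on the right; that is, $L$ is a solvable Lie subalgebra, of dimension $n<\infty$, of the algebra of bounded operators on $E$, where operators are written on the right, so that $e[x,y]=(ex)y-(ey)x$ for $e\in E$, $x,y\in L$. For a linear functional $f\in L^*$ vanishing on $L^2=[L,L]$, let $d_p(f)\colon E\otimes\wedge^pL\to E\otimes\wedge^{p-1}L$ ($1\le p\le n$) be the linear map $$d_p(f)\,e\langle x_1\wedge\dots\wedge x_p\rangle=\sum_{k=1}^{p}(-1)^{k+1}e(x_k-f(x_k))\langle x_1\wedge\dots\wedge\widehat{x_k}\wedge\dots\wedge x_p\rangle+\sum_{1\le k<l\le p}(-1)^{k+l}e\langle[x_k,x_l]\wedge x_1\wedge\dots\wedge\widehat{x_k}\wedge\dots\wedge\widehat{x_l}\wedge\dots\wedge x_p\rangle,$$ where $\widehat{\ }$ means deletion, and let $d_p(f)=0$ for $p\le 0$ and $p\ge n+1$. Put $$\varSigma_p(L,E)=\{f\in L^*\colon f(L^2)=0,\ R(d_{p+1}(f))\ne\operatorname{Ker}(d_p(f))\},\qquad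 \sigma_{\delta,k}(L,E)=\bigcup_{0\le p\le k}\varSigma_p(L,E)\quad(0\le k\le n),$$ where $R$ denotes the range. Then, for every $k$ with $0\le k\le n$, the set $\sigma_{\delta,k}(L,E)$ is nonempty. -/

import Mathlib

open scoped TensorProduct

attribute [local instance 100] LieRing.ofAssociativeRing

noncomputable section

namespace SolvableSpectrum

/-! ### The Koszul (Chevalley-Eilenberg) complex of a right action, twisted by a functional

Operators on `E` act on the right.  The algebra of bounded operators on `E` with the product of
right operators, `e (S T) = (e S) T`, is `(E →L[ℂ] E)ᵐᵒᵖ`; its commutator is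
`e [S, T] = (e S) T - (e T) S`. -/

section Exterior

variable {L : Type*} [LieRing L] [LieAlgebra ℂ L]

/-- `x ↦ ((x₁, …, x_p) ↦ x ⊗ (x₁ ∧ ⋯ ∧ x_p))`. -/
def tmulWedge (p : ℕ) : L →ₗ[ℂ] L [⋀^Fin p]→ₗ[ℂ] (L ⊗[ℂ] ⋀[ℂ]^p L) where
  toFun x := (TensorProduct.mk ℂ L (⋀[ℂ]^p L) x).compAlternatingMap (exteriorPower.ιMulti ℂ p)
  map_add' x y := by ext v; simp
  map_smul' c x := by ext v; simp

/-- The linear map `⋀^(p+1) L → L ⊗ ⋀^p L`,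
`x₁ ∧ ⋯ ∧ x_{p+1} ↦ ∑ k, (-1)^(k+1) x_k ⊗ (x₁ ∧ ⋯ ∧ x̂_k ∧ ⋯ ∧ x_{p+1})`. -/
def extract (p : ℕ) : ⋀[ℂ]^(p + 1) L →ₗ[ℂ] L ⊗[ℂ] ⋀[ℂ]^p L :=
  exteriorPower.alternatingMapLinearEquiv (AlternatingMap.alternatizeUncurryFin (tmulWedge p))

/-- `(x, y) ↦ ((x₁, …, x_p) ↦ [x, y] ∧ x₁ ∧ ⋯ ∧ x_p)`. -/
def bracketWedge (p : ℕ) : L →ₗ[ℂ] L →ₗ[ℂ] L [⋀^Fin p]→ₗ[ℂ] ⋀[ℂ]^(p + 1) L :=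
  (LieModule.toEnd ℂ L L : L →ₗ[ℂ] Module.End ℂ L).compr₂
    (exteriorPower.ιMulti ℂ (p + 1)).curryLeft

/-- The linear map `⋀^(p+1) L → ⋀^p L`,
`x₁ ∧ ⋯ ∧ x_{p+1} ↦ ∑ k < l, (-1)^(k+l) [x_k, x_l] ∧ x₁ ∧ ⋯ ∧ x̂_k ∧ ⋯ ∧ x̂_l ∧ ⋯ ∧ x_{p+1}`.
It is obtained from the alternating sum over all ordered pairs `(k, l)`, `k ≠ l`, which counts
every pair `k < l` twice; see `bracketBoundary_ιMulti`. -/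
def bracketBoundary : (p : ℕ) → ⋀[ℂ]^(p + 1) L →ₗ[ℂ] ⋀[ℂ]^p L
  | 0 => 0
  | p + 1 => exteriorPower.alternatingMapLinearEquiv
      (-(1 / 2 : ℂ) • AlternatingMap.alternatizeUncurryFin
        (AlternatingMap.alternatizeUncurryFinLM ∘ₗ bracketWedge p))

theorem extract_ιMulti (p : ℕ) (v : Fin (p + 1) → L) :
    extract p (exteriorPower.ιMulti ℂ (p + 1) v) =
      ∑ k : Fin (p + 1), (-1 : ℤ) ^ (k : ℕ) •
        (v k ⊗ₜ[ℂ] exteriorPower.ιMulti ℂ p (k.removeNth v)) := by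
  simp [extract, AlternatingMap.alternatizeUncurryFin_apply, tmulWedge]

/-- A pair `i ≤ j` of indices in `Fin (p + 1)` encodes the pair `i.castSucc < j.succ` in
`Fin (p + 2)`. -/
theorem bracketBoundary_ιMulti (p : ℕ) (v : Fin (p + 2) → L) :
    bracketBoundary (p + 1) (exteriorPower.ιMulti ℂ (p + 2) v) =
      ∑ i : Fin (p + 1), ∑ j ≥ i, (-1 : ℤ) ^ ((i.castSucc : ℕ) + (j.succ : ℕ)) •
        exteriorPower.ιMulti ℂ (p + 1)
          (Matrix.vecCons ⁅v i.castSucc, v j.succ⁆ (j.removeNth (i.castSucc.removeNth v))) := by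
  simp only [bracketBoundary, exteriorPower.alternatingMapLinearEquiv_apply_ιMulti,
    AlternatingMap.smul_apply,
    AlternatingMap.alternatizeUncurryFin_alternatizeUncurryFinLM_comp_apply, Finset.smul_sum]
  refine Finset.sum_congr rfl fun i _ => Finset.sum_congr rfl fun j _ => ?_
  have h : ∀ (x y : L) (w : Fin p → L), bracketWedge p x y w =
      exteriorPower.ιMulti ℂ (p + 1) (Matrix.vecCons ⁅x, y⁆ w) := fun x y w => by
    simp [bracketWedge]
  have h' : ∀ (x y : L) (w : Fin p → L), bracketWedge p y x w = -bracketWedge p x y w :=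
    fun x y w => by
      have : bracketWedge p y x = -bracketWedge p x y := by
        simp only [bracketWedge, LinearMap.compr₂_apply, LieHom.coe_toLinearMap,
          LieModule.toEnd_apply_apply]
        rw [← lie_skew y x, map_neg]
      rw [this, AlternatingMap.neg_apply]
  rw [h' (v i.castSucc) (v j.succ), ← h (v i.castSucc) (v j.succ), Fin.val_castSucc,
    Fin.val_succ, ← add_assoc, pow_succ]
  generalize bracketWedge p (v i.castSucc) (v j.succ) (j.removeNth (i.castSucc.removeNth v)) = z
  rcases neg_one_pow_eq_or ℤ ((i : ℕ) + j) with h1 | h1 <;> rw [h1] <;> module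

end Exterior

variable {L : Type*} [LieRing L] [LieAlgebra ℂ L]
  {E : Type*} [NormedAddCommGroup E] [NormedSpace ℂ E]

/-- The linear map `E ⊗ L → E`, `e ⊗ x ↦ e (x - f x)`. -/
def act (ρ : L →ₗ⁅ℂ⁆ (E →L[ℂ] E)ᵐᵒᵖ) (f : Module.Dual ℂ L) : E ⊗[ℂ] L →ₗ[ℂ] E :=
  TensorProduct.lift <| LinearMap.mk₂ ℂ (fun e x => (ρ x).unop e - f x • e)
    (by intros; simp; abel) (by intros; simp [smul_sub, smul_smul, mul_comm])
    (by intros; simp [add_smul]; abel) (by intros; simp [smul_sub, smul_smul])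

/-- The differential `d_{p+1}(f) : E ⊗ ⋀^(p+1) L → E ⊗ ⋀^p L`,
`e ⟨x₁ ∧ ⋯ ∧ x_{p+1}⟩ ↦ ∑ k, (-1)^(k+1) e (x_k - f x_k) ⟨x₁ ∧ ⋯ ∧ x̂_k ∧ ⋯ ∧ x_{p+1}⟩
+ ∑ k < l, (-1)^(k+l) e ⟨[x_k, x_l] ∧ x₁ ∧ ⋯ ∧ x̂_k ∧ ⋯ ∧ x̂_l ∧ ⋯ ∧ x_{p+1}⟩`. -/
def d (ρ : L →ₗ⁅ℂ⁆ (E →L[ℂ] E)ᵐᵒᵖ) (f : Module.Dual ℂ L) (p : ℕ) :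
    E ⊗[ℂ] ⋀[ℂ]^(p + 1) L →ₗ[ℂ] E ⊗[ℂ] ⋀[ℂ]^p L :=
  (act ρ f).rTensor (⋀[ℂ]^p L) ∘ₗ (TensorProduct.assoc ℂ E L (⋀[ℂ]^p L)).symm.toLinearMap ∘ₗ
      (extract p).lTensor E
    + (bracketBoundary p).lTensor E

theorem d_zero_tmul (ρ : L →ₗ⁅ℂ⁆ (E →L[ℂ] E)ᵐᵒᵖ) (f : Module.Dual ℂ L) (e : E)
    (v : Fin 1 → L) :
    d ρ f 0 (e ⊗ₜ exteriorPower.ιMulti ℂ 1 v) =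
      ((ρ (v 0)).unop e - f (v 0) • e) ⊗ₜ exteriorPower.ιMulti ℂ 0 (Fin.removeNth 0 v) := by
  simp [d, extract_ιMulti, act, bracketBoundary]

theorem d_succ_tmul (ρ : L →ₗ⁅ℂ⁆ (E →L[ℂ] E)ᵐᵒᵖ) (f : Module.Dual ℂ L) (p : ℕ) (e : E)
    (v : Fin (p + 2) → L) :
    d ρ f (p + 1) (e ⊗ₜ exteriorPower.ιMulti ℂ (p + 2) v) =
      (∑ k : Fin (p + 2), (-1 : ℤ) ^ (k : ℕ) •
        (((ρ (v k)).unop e - f (v k) • e) ⊗ₜ exteriorPower.ιMulti ℂ (p + 1) (k.removeNth v))) +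
      ∑ i : Fin (p + 1), ∑ j ≥ i, (-1 : ℤ) ^ ((i.castSucc : ℕ) + (j.succ : ℕ)) •
        (e ⊗ₜ exteriorPower.ιMulti ℂ (p + 1)
          (Matrix.vecCons ⁅v i.castSucc, v j.succ⁆ (j.removeNth (i.castSucc.removeNth v)))) := by
  simp only [d, LinearMap.add_apply, LinearMap.comp_apply, LinearMap.lTensor_tmul,
    extract_ιMulti, bracketBoundary_ιMulti, TensorProduct.tmul_sum, map_sum,
    TensorProduct.tmul_smul, map_zsmul]
  simp [act]

/-- The kernel of `d_p(f)`, where `d_0(f) = 0`. -/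
def cycles (ρ : L →ₗ⁅ℂ⁆ (E →L[ℂ] E)ᵐᵒᵖ) (f : Module.Dual ℂ L) :
    (p : ℕ) → Submodule ℂ (E ⊗[ℂ] ⋀[ℂ]^p L)
  | 0 => ⊤
  | p + 1 => LinearMap.ker (d ρ f p)

/-- The range of `d_{p+1}(f)`. -/
def boundaries (ρ : L →ₗ⁅ℂ⁆ (E →L[ℂ] E)ᵐᵒᵖ) (f : Module.Dual ℂ L) (p : ℕ) :
    Submodule ℂ (E ⊗[ℂ] ⋀[ℂ]^p L) :=
  LinearMap.range (d ρ f p)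

/-- `Σ_p(L, E)`: the `f ∈ L^*` vanishing on `L² = [L, L]` such that
`H_p(E ⊗ ⋀ L, d(f)) ≠ 0`, i.e. `R(d_{p+1}(f)) ≠ Ker(d_p(f))`. -/
def homologySpectrum (ρ : L →ₗ⁅ℂ⁆ (E →L[ℂ] E)ᵐᵒᵖ) (p : ℕ) : Set (Module.Dual ℂ L) :=
  {f | (∀ x y : L, f ⁅x, y⁆ = 0) ∧ boundaries ρ f p ≠ cycles ρ f p}

/-- `σ_{δ,k}(L, E)`, the union of the `Σ_p(L, E)` over `0 ≤ p ≤ k`. -/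
def sigmaDelta (ρ : L →ₗ⁅ℂ⁆ (E →L[ℂ] E)ᵐᵒᵖ) (k : ℕ) : Set (Module.Dual ℂ L) :=
  ⋃ p ∈ Set.Iic k, homologySpectrum ρ p

end SolvableSpectrum

end

/-! ### Approximate eigenvalues of a bounded operator. -/

open Filter Topology
open scoped BoundedContinuousFunction

/-! Every `σ_{δ,k}` contains `Σ_0`, so a single `f` in `Σ_0` suffices: a character `f` for which the
elements `e(x - f x)` do not span `E`. By duality, it is enough that `L`, acting on the left on the
dual of `E`, has an approximate common eigenvector: if the span were `E`, the open mapping theorem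
would bound every functional `φ` below by the norms of the `(x - f x)φ`.

This is Lie's theorem up to `ε` (`LieAlgebra.exists_approximate_weight`), by induction on dimension.
An ideal `I` of codimension one has an approximate weight; in bounded sequences modulo null
sequences it becomes an exact weight with closed weight space `W ≠ 0`. The complementary element `y`
preserves `W`, by a Liouville argument replacing the trace argument of finite dimension
(`ContinuousLinearMap.lie_apply_eq_zero_of_forall_ad_pow_apply_mem_span`). A boundary point of the
spectrum of `y` on `W` is an approximate eigenvalue, and the estimate descends to the original
space. -/

theorem ContinuousLinearMap.exists_approximate_eigenvalue {W : Type*} [NormedAddCommGroup W]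
    [NormedSpace ℂ W] [CompleteSpace W] [Nontrivial W] (T : W →L[ℂ] W) :
    ∃ μ : ℂ, ∀ ε > 0, ∃ w : W, ‖T w - μ • w‖ < ε * ‖w‖ := by
  have hne : (spectrum ℂ T).Nonempty := spectrum.nonempty T
  have hcl : IsClosed (spectrum ℂ T) := spectrum.isClosed T
  have hfr : (frontier (spectrum ℂ T)).Nonempty := by
    rw [nonempty_frontier_iff]
    exact ⟨hne, fun h => NormedSpace.unbounded_univ ℂ ℂ (h ▸ spectrum.isBounded T)⟩
  obtain ⟨μ, hμ⟩ := hfr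
  have hμσ : μ ∈ spectrum ℂ T := hcl.frontier_subset hμ
  refine ⟨μ, fun ε hε => ?_⟩
  -- If `T - μ` is bounded below by `ε`, then for `ν` in the resolvent set within `ε / 2` of `μ` the
  -- inverse of `ν - T` has norm at most `2 / ε`, so `μ - T` is an invertible perturbation of `ν -
  -- T`.
  by_contra! hb
  have hμc : μ ∈ closure (spectrum ℂ T)ᶜ := by
    rw [frontier_eq_closure_inter_closure] at hμ
    exact hμ.2
  obtain ⟨ν, hν, hd⟩ := Metric.mem_closure_iff.1 hμc (ε / 2) (by positivity)
  rw [Set.mem_compl_iff, spectrum.notMem_iff] at hν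
  apply hμσ
  obtain ⟨U, hU⟩ := hν
  have hUT : ∀ w, (U : W →L[ℂ] W) w = ν • w - T w := fun w => by
    rw [hU]; simp [Algebra.algebraMap_eq_smul_one]
  have hlow : ∀ w, ε / 2 * ‖w‖ ≤ ‖(U : W →L[ℂ] W) w‖ := fun w => by
    have h1 := hb w
    have h2 : T w - μ • w = -((U : W →L[ℂ] W) w) + (ν - μ) • w := by rw [hUT]; module
    have h3 := norm_add_le (-((U : W →L[ℂ] W) w)) ((ν - μ) • w)
    rw [← h2, norm_neg, norm_smul] at h3
    have h4 : ‖ν - μ‖ * ‖w‖ ≤ ε / 2 * ‖w‖ := by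
      gcongr
      rw [← dist_eq_norm, dist_comm]
      exact hd.le
    linarith
  have hinv : ‖((U⁻¹ : (W →L[ℂ] W)ˣ) : W →L[ℂ] W)‖ ≤ 2 / ε := by
    refine ContinuousLinearMap.opNorm_le_bound _ (by positivity) fun w => ?_
    have h := hlow (((U⁻¹ : (W →L[ℂ] W)ˣ) : W →L[ℂ] W) w)
    rw [← mul_apply_eq_comp, Units.mul_inv, one_apply_eq_self] at h
    rw [div_mul_eq_mul_div, le_div_iff₀ hε]
    linarith
  have hpos : 0 < ‖((U⁻¹ : (W →L[ℂ] W)ˣ) : W →L[ℂ] W)‖ := Units.norm_pos _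
  have := (U.add (algebraMap ℂ (W →L[ℂ] W) (μ - ν)) ?_).isUnit
  · rw [spectrum.mem_resolventSet_iff]
    convert! this using 1
    rw [Units.val_add, hU, map_sub]
    abel
  · rw [norm_algebraMap', ← dist_eq_norm]
    refine hd.trans_le ?_
    rw [← inv_div]
    exact inv_anti₀ hpos hinv

/-! ### Conjugation by one-parameter groups and Liouville's theorem. -/

theorem NormedSpace.exp_smul_mulLeft_sub_mulRight_apply {A : Type*} [NormedRing A]
    [NormedAlgebra ℂ A] [CompleteSpace A] (X Y : A) (t : ℂ) :
    NormedSpace.exp (t • (ContinuousLinearMap.mul ℂ A Y - (ContinuousLinearMap.mul ℂ A).flip Y)) X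
      = NormedSpace.exp (t • Y) * X * NormedSpace.exp (-(t • Y)) := by
  let l : A →+* (A →L[ℂ] A) :=
    { toFun := ContinuousLinearMap.mul ℂ A
      map_one' := by ext; simp
      map_mul' := fun a b => by ext; simp [mul_assoc]
      map_zero' := by simp
      map_add' := by simp }
  let r : Aᵐᵒᵖ →+* (A →L[ℂ] A) :=
    { toFun := fun a => (ContinuousLinearMap.mul ℂ A).flip a.unop
      map_one' := by ext; simp
      map_mul' := fun a b => by ext; simp [mul_assoc]
      map_zero' := by simp
      map_add' := by simp }
  have hl : Continuous l := (ContinuousLinearMap.mul ℂ A).continuous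
  have hr : Continuous r :=
    (ContinuousLinearMap.mul ℂ A).flip.continuous.comp MulOpposite.continuous_unop
  let _ : NormedAlgebra ℚ A := NormedAlgebra.restrictScalars ℚ ℂ A
  let _ : NormedAlgebra ℚ (A →L[ℂ] A) := NormedAlgebra.restrictScalars ℚ ℂ _
  have h1 : t • (ContinuousLinearMap.mul ℂ A Y - (ContinuousLinearMap.mul ℂ A).flip Y)
      = l (t • Y) + r (MulOpposite.op (-(t • Y))) := by
    ext a; simp [l, r, sub_eq_add_neg]
  have hc : Commute (l (t • Y)) (r (MulOpposite.op (-(t • Y)))) := by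
    ext a; simp [l, r, mul_assoc]
  rw [h1, NormedSpace.exp_add_of_commute hc, ← NormedSpace.map_exp l hl,
    ← NormedSpace.map_exp r hr, NormedSpace.exp_op]
  simp [l, r, mul_assoc]

/-- The conjugate is `exp (t ad Y) X`, a convergent series in the iterated brackets. -/
theorem NormedSpace.exp_mul_exp_neg_mem_of_forall_ad_pow_mem {A : Type*} [NormedRing A]
    [NormedAlgebra ℂ A] [CompleteSpace A] (X Y : A) (S : Submodule ℂ A) (hS : IsClosed (S : Set A))
    (h : ∀ n : ℕ, (LieAlgebra.ad ℂ A Y ^ n) X ∈ S) (t : ℂ) :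
    NormedSpace.exp (t • Y) * X * NormedSpace.exp (-(t • Y)) ∈ S := by
  rw [← NormedSpace.exp_smul_mulLeft_sub_mulRight_apply]
  set D := ContinuousLinearMap.mul ℂ A Y - (ContinuousLinearMap.mul ℂ A).flip Y with hD
  have hDX : ∀ Z, D Z = ⁅Y, Z⁆ := fun Z => by simp [hD, LieRing.of_associative_ring_bracket]
  have hDn : ∀ n : ℕ, (D ^ n) X = (LieAlgebra.ad ℂ A Y ^ n) X := fun n => by
    induction n with
    | zero => simp
    | succ n ih => rw [pow_succ', pow_succ', mul_apply_eq_comp, ih, hDX]; rfl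
  have hs := (NormedSpace.exp_series_hasSum_exp' (𝕂 := ℂ) (t • D)).mapL
    (ContinuousLinearMap.apply ℂ A X)
  refine hS.mem_of_tendsto hs (Eventually.of_forall fun s => Submodule.sum_mem _ fun n _ => ?_)
  rw [smul_pow, map_smul, map_smul, ContinuousLinearMap.apply_apply, hDn]
  exact Submodule.smul_mem _ _ (Submodule.smul_mem _ _ (h n))

theorem NormedSpace.hasDerivAt_exp_mul_exp_neg {A : Type*} [NormedRing A]
    [NormedAlgebra ℂ A] [CompleteSpace A] (X Y : A) (t : ℂ) :
    HasDerivAt (fun t : ℂ => NormedSpace.exp (t • Y) * X * NormedSpace.exp (-(t • Y)))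
      (NormedSpace.exp (t • Y) * ⁅Y, X⁆ * NormedSpace.exp (-(t • Y))) t := by
  have h1 := hasDerivAt_exp_smul_const Y t
  have h2 := hasDerivAt_exp_smul_const' (-Y) t
  simp only [smul_neg] at h2
  convert! (h1.mul_const X).mul h2 using 1
  rw [LieRing.of_associative_ring_bracket]
  noncomm_ring

/-- The entire function `t ↦ exp (tY) X exp (-tY) v` stays in the line of `v` and is bounded, hence
constant; its derivative at `0` is `⁅Y, X⁆ v`. -/
theorem ContinuousLinearMap.lie_apply_eq_zero_of_forall_ad_pow_apply_mem_span {G : Type*}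
    [NormedAddCommGroup G] [NormedSpace ℂ G] [CompleteSpace G] (X Y : G →L[ℂ] G) (v : G)
    (h : ∀ n : ℕ, ((LieAlgebra.ad ℂ (G →L[ℂ] G) Y ^ n) X) v ∈ Submodule.span ℂ {v}) :
    ⁅Y, X⁆ v = 0 := by
  by_cases hv : v = 0
  · simp [hv]
  set φ : (G →L[ℂ] G) →L[ℂ] G := ContinuousLinearMap.apply ℂ G v with hφ
  set Z : ℂ → (G →L[ℂ] G) :=
    fun t => NormedSpace.exp (t • Y) * X * NormedSpace.exp (-(t • Y)) with hZ
  have hder : ∀ t : ℂ, HasDerivAt (fun t : ℂ => φ (Z t))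
      (φ (NormedSpace.exp (t • Y) * ⁅Y, X⁆ * NormedSpace.exp (-(t • Y)))) t := fun t =>
    φ.hasFDerivAt.comp_hasDerivAt t (NormedSpace.hasDerivAt_exp_mul_exp_neg X Y t)
  have hmem : ∀ t : ℂ, φ (Z t) ∈ Submodule.span ℂ {v} :=
    NormedSpace.exp_mul_exp_neg_mem_of_forall_ad_pow_mem X Y
      ((Submodule.span ℂ {v}).comap φ.toLinearMap)
      ((Submodule.closed_of_finiteDimensional (Submodule.span ℂ {v})).preimage φ.continuous) h
  -- If `Z t v = c v`, then `exp (-tY) v` is an eigenvector of `X` with eigenvalue `c`, so `‖c‖ ≤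
  -- ‖X‖` for every `t`.
  have hbd : ∀ t : ℂ, ‖φ (Z t)‖ ≤ ‖X‖ * ‖v‖ := fun t => by
    obtain ⟨c, hc⟩ := Submodule.mem_span_singleton.1 (hmem t)
    rw [← hc, norm_smul]
    gcongr
    set w := NormedSpace.exp (-(t • Y)) v with hw
    let _ : NormedAlgebra ℚ (G →L[ℂ] G) := NormedAlgebra.restrictScalars ℚ ℂ _
    have hinv : NormedSpace.exp (t • Y) * NormedSpace.exp (-(t • Y)) = 1 := by
      rw [← NormedSpace.exp_add_of_commute (Commute.refl (t • Y)).neg_right]; simp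
    have hinv' : NormedSpace.exp (-(t • Y)) * NormedSpace.exp (t • Y) = 1 := by
      rw [← NormedSpace.exp_add_of_commute (Commute.refl (t • Y)).neg_left]; simp
    have hw0 : w ≠ 0 := fun h0 => hv <| by
      have := congr($hinv v)
      rw [mul_apply_eq_comp, ← hw, h0, map_zero] at this
      exact this.symm
    have hXw : X w = c • w := by
      have h1 := congr(NormedSpace.exp (-(t • Y)) $hc)
      rw [map_smul, hφ, ContinuousLinearMap.apply_apply, hZ, ← mul_apply_eq_comp, ← mul_assoc,
        ← mul_assoc, hinv', one_mul] at h1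
      exact h1.symm
    have h2 := X.le_opNorm w
    rw [hXw, norm_smul] at h2
    exact le_of_mul_le_mul_right h2 (norm_pos_iff.2 hw0)
  have hconst : ∀ t : ℂ, φ (Z t) = φ (Z 0) := fun t =>
    Differentiable.apply_eq_apply_of_bounded (f := fun t : ℂ => φ (Z t))
      (fun t => (hder t).differentiableAt)
      (isBounded_iff_forall_norm_le.2 ⟨_, by rintro _ ⟨t, rfl⟩; exact hbd t⟩) t 0
  have h0 := hder 0
  rw [funext hconst] at h0
  have := h0.unique (hasDerivAt_const _ _)
  simpa [hφ] using this

/-! ### Bounded sequences modulo null sequences. -/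

section SequenceQuotient

variable (F : Type*) [NormedAddCommGroup F] [NormedSpace ℂ F]

/-- The bounded sequences in `F` tending to zero. -/
def nullSequences : Submodule ℂ (ℕ →ᵇ F) where
  carrier := {a | Tendsto a atTop (𝓝 0)}
  add_mem' ha hb := by simpa using! Tendsto.add ha hb
  zero_mem' := tendsto_const_nhds
  smul_mem' c a ha := by simpa using! Tendsto.const_smul ha c

variable {F}

theorem mem_nullSequences {a : ℕ →ᵇ F} : a ∈ nullSequences F ↔ Tendsto a atTop (𝓝 0) := Iff.rfl

instance isClosed_nullSequences : IsClosed (nullSequences F : Set (ℕ →ᵇ F)) := by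
  refine isClosed_of_closure_subset fun a ha => ?_
  refine Metric.tendsto_atTop.2 fun ε hε => ?_
  obtain ⟨b, hb, hab⟩ := Metric.mem_closure_iff.1 ha (ε / 2) (by positivity)
  obtain ⟨N, hN⟩ := Metric.tendsto_atTop.1 (mem_nullSequences.1 hb) (ε / 2) (by positivity)
  refine ⟨N, fun n hn => (dist_triangle _ (b n) _).trans_lt ?_⟩
  have := (BoundedContinuousFunction.dist_coe_le_dist (f := a) (g := b) n).trans_lt hab
  linarith [hN n hn]

variable (F) in
/-- Bounded sequences in `F` modulo the sequences tending to zero. -/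
abbrev SequenceQuotient : Type _ := (ℕ →ᵇ F) ⧸ nullSequences F

namespace SequenceQuotient

/-- The operator on `SequenceQuotient F` given by applying `T` termwise. -/
noncomputable def map (T : F →L[ℂ] F) : SequenceQuotient F →L[ℂ] SequenceQuotient F :=
  (nullSequences F).liftQL ((nullSequences F).mkQL ∘L T.compLeftContinuousBounded ℕ) fun a ha => by
    have : T.compLeftContinuousBounded ℕ a ∈ nullSequences F := by
      have := (T.continuous.tendsto 0).comp (mem_nullSequences.1 ha)
      rwa [map_zero] at this
    simpa using this

theorem map_mk (T : F →L[ℂ] F) (a : ℕ →ᵇ F) :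
    map T (Submodule.Quotient.mk a) = Submodule.Quotient.mk (T.compLeftContinuousBounded ℕ a) :=
  rfl

theorem map_add (S T : F →L[ℂ] F) : map (S + T) = map S + map T := by
  ext v
  induction v using Submodule.Quotient.induction_on
  rfl

theorem map_smul (c : ℂ) (T : F →L[ℂ] F) : map (c • T) = c • map T := by
  ext v
  induction v using Submodule.Quotient.induction_on
  rfl

theorem map_one : map (1 : F →L[ℂ] F) = 1 := by
  ext v
  induction v using Submodule.Quotient.induction_on
  rfl

theorem map_mul (S T : F →L[ℂ] F) : map (S * T) = map S * map T := by
  ext v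
  induction v using Submodule.Quotient.induction_on
  rfl

variable (F) in
/-- `SequenceQuotient.map` as a homomorphism of algebras. -/
noncomputable def mapAlgHom : (F →L[ℂ] F) →ₐ[ℂ] (SequenceQuotient F →L[ℂ] SequenceQuotient F) :=
  AlgHom.ofLinearMap { toFun := map, map_add' := map_add, map_smul' := map_smul } map_one map_mul

theorem norm_mk_le {a : ℕ →ᵇ F} {C : ℝ} (hC : 0 ≤ C) (h : ∀ᶠ n in atTop, ‖a n‖ ≤ C) :
    ‖(Submodule.Quotient.mk a : SequenceQuotient F)‖ ≤ C := by
  obtain ⟨N, hN⟩ := eventually_atTop.1 h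
  let b : ℕ →ᵇ F := BoundedContinuousFunction.ofNormedAddCommGroup
    (fun n => if N ≤ n then a n else 0) continuous_of_discreteTopology C fun n => by
      split_ifs with hn
      · exact hN n hn
      · simpa using hC
  have hab : (Submodule.Quotient.mk a : SequenceQuotient F) = Submodule.Quotient.mk b := by
    rw [Submodule.Quotient.eq, mem_nullSequences]
    refine tendsto_const_nhds.congr' ?_
    filter_upwards [eventually_ge_atTop N] with n hn
    simp [b, hn]
  rw [hab]
  refine (Submodule.Quotient.norm_mk_le _ b).trans ?_
  exact BoundedContinuousFunction.norm_ofNormedAddCommGroup_le _ hC _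

theorem eventually_norm_lt {a : ℕ →ᵇ F} {C : ℝ}
    (h : ‖(Submodule.Quotient.mk a : SequenceQuotient F)‖ < C) : ∀ᶠ n in atTop, ‖a n‖ < C := by
  obtain ⟨b, hb, hbC⟩ := Submodule.Quotient.norm_mk_lt (S := nullSequences F)
    (Submodule.Quotient.mk a : SequenceQuotient F) (sub_pos.2 h)
  have hab : Tendsto (a - b) atTop (𝓝 0) :=
    mem_nullSequences.1 ((Submodule.Quotient.eq _).1 hb.symm)
  have hbC : ‖b‖ < C := by linarith
  filter_upwards [hab.norm.eventually_lt_const (u := C - ‖b‖) (by simpa using hbC)] with n hn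
  have h1 := norm_add_le ((a - b) n) (b n)
  have h2 := b.norm_coe_le_norm n
  have h3 : (a - b) n + b n = a n := by simp
  rw [h3] at h1
  linarith

/-- The quotient norm only sees tails of sequences, so a lower bound `ε * ‖u‖ ≤ ∑ ‖T i u‖` on `F`
would pass to the quotient. -/
theorem exists_sum_norm_apply_lt {ι : Type*} (s : Finset ι) (T : ι → F →L[ℂ] F) {ε : ℝ} (hε : 0 < ε)
    {v : SequenceQuotient F} (h : ∑ i ∈ s, ‖map (T i) v‖ < ε * ‖v‖) :
    ∃ u : F, ∑ i ∈ s, ‖T i u‖ < ε * ‖u‖ := by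
  by_contra! hb
  refine h.not_ge (le_of_forall_pos_le_add fun δ hδ => ?_)
  induction v using Submodule.Quotient.induction_on with | _ a
  have hev : ∀ i ∈ s, ∀ᶠ n in atTop,
      ‖T i (a n)‖ < ‖map (T i) (Submodule.Quotient.mk a)‖ + δ / (s.card + 1) := fun i _ =>
    eventually_norm_lt (a := (T i).compLeftContinuousBounded ℕ a)
      (lt_add_of_pos_right _ (by positivity))
  have h0 : 0 ≤ ∑ i ∈ s, ‖map (T i) (Submodule.Quotient.mk a)‖ :=
    Finset.sum_nonneg fun _ _ => norm_nonneg _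
  rw [mul_comm, ← le_div_iff₀ hε]
  refine norm_mk_le (by positivity) ?_
  filter_upwards [(Filter.eventually_all_finset s).2 hev] with n hn
  rw [le_div_iff₀ hε, mul_comm]
  refine (hb (a n)).trans ((Finset.sum_le_sum fun i hi => (hn i hi).le).trans ?_)
  rw [Finset.sum_add_distrib, Finset.sum_const, nsmul_eq_mul]
  gcongr
  rw [mul_div_assoc', div_le_iff₀ (by positivity)]
  nlinarith

theorem exists_ne_zero_of_tendsto {u : ℕ → F} (hu : ∀ n, ‖u n‖ = 1) :
    ∃ v : SequenceQuotient F, v ≠ 0 ∧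
      ∀ T : F →L[ℂ] F, Tendsto (fun n => T (u n)) atTop (𝓝 0) → map T v = 0 := by
  let a : ℕ →ᵇ F := BoundedContinuousFunction.ofNormedAddCommGroup u
    continuous_of_discreteTopology 1 fun n => (hu n).le
  refine ⟨Submodule.Quotient.mk a, fun h => ?_, fun T hT => ?_⟩
  · obtain ⟨n, hn⟩ := (eventually_norm_lt (a := a) (C := 1) (by rw [h]; simp)).exists
    exact hn.ne (hu n)
  · rw [map_mk, Submodule.Quotient.mk_eq_zero]
    exact hT

end SequenceQuotient

end SequenceQuotient

/-! ### Weight spaces and the approximate Lie theorem. -/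

theorem exists_unit_sequence_of_approximate_weight {F : Type*} [NormedAddCommGroup F]
    [NormedSpace ℂ F] {V : Type*} [AddCommGroup V] [Module ℂ V] [FiniteDimensional ℂ V]
    (T : V →ₗ[ℂ] F →L[ℂ] F)
    (h : ∀ (s : Finset V) (ε : ℝ), 0 < ε → ∃ u : F, ∑ x ∈ s, ‖T x u‖ < ε * ‖u‖) :
    ∃ u : ℕ → F, (∀ n, ‖u n‖ = 1) ∧ ∀ x, Tendsto (fun n => T x (u n)) atTop (𝓝 0) := by
  classical
  obtain ⟨s, hs⟩ := Module.finite_def.1 (inferInstance : Module.Finite ℂ V)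
  have h1 : ∀ n : ℕ, ∃ u : F, ‖u‖ = 1 ∧ ∀ x ∈ s, ‖T x u‖ ≤ 1 / ((n : ℝ) + 1) := fun n => by
    obtain ⟨u, hu⟩ := h s (1 / ((n : ℝ) + 1)) (by positivity)
    have hu0 : 0 < ‖u‖ := by
      by_contra h0
      have : ‖u‖ = 0 := le_antisymm (not_lt.1 h0) (norm_nonneg _)
      rw [this, mul_zero] at hu
      exact hu.not_ge (Finset.sum_nonneg fun _ _ => norm_nonneg _)
    refine ⟨(‖u‖⁻¹ : ℂ) • u, by simp [norm_smul, hu0.ne'], fun x hx => ?_⟩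
    have h2 := (Finset.single_le_sum (f := fun x => ‖T x u‖) (fun _ _ => norm_nonneg _) hx).trans
      hu.le
    rw [map_smul, norm_smul, norm_inv, Complex.norm_real, norm_norm, inv_mul_le_iff₀ hu0, mul_comm]
    exact h2
  choose u hu1 hu2 using h1
  refine ⟨u, hu1, fun x => ?_⟩
  have hx : x ∈ Submodule.span ℂ (s : Set V) := hs ▸ Submodule.mem_top
  induction hx using Submodule.span_induction with
  | mem x hx => exact squeeze_zero_norm (fun n => hu2 n x hx) tendsto_one_div_add_atTop_nhds_zero_nat
  | zero => simp
  | add x y _ _ hx hy => simpa using hx.add hy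
  | smul c x _ hx => simpa using hx.const_smul c

/-- The common eigenvectors of the operators `T x`, with eigenvalues `g x`. -/
def closedWeightSpace {V G : Type*} [NormedAddCommGroup G] [NormedSpace ℂ G]
    (T : V → G →L[ℂ] G) (g : V → ℂ) : Submodule ℂ G :=
  ⨅ x, (T x - g x • (1 : G →L[ℂ] G)).ker

theorem mem_closedWeightSpace {V G : Type*} [NormedAddCommGroup G] [NormedSpace ℂ G]
    {T : V → G →L[ℂ] G} {g : V → ℂ} {w : G} :
    w ∈ closedWeightSpace T g ↔ ∀ x, T x w = g x • w := by
  simp [closedWeightSpace, Submodule.mem_iInf, sub_eq_zero]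

theorem isClosed_closedWeightSpace {V G : Type*} [NormedAddCommGroup G] [NormedSpace ℂ G]
    (T : V → G →L[ℂ] G) (g : V → ℂ) : IsClosed (closedWeightSpace T g : Set G) := by
  rw [closedWeightSpace, Submodule.coe_iInf]
  exact isClosed_iInter fun x => ContinuousLinearMap.isClosed_ker _

/-- Iterated brackets of `ρ y` with `ρ x` stay in the image of `I`, so they map `w` into its own
line and `⁅ρ y, ρ x⁆ w = 0`. -/
theorem apply_mem_closedWeightSpace {G : Type*} [NormedAddCommGroup G] [NormedSpace ℂ G]
    [CompleteSpace G] {L : Type*} [LieRing L] [LieAlgebra ℂ L] (I : LieIdeal ℂ L)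
    (ρ : L →ₗ⁅ℂ⁆ (G →L[ℂ] G)) (g : I → ℂ) (y : L) {w : G}
    (hw : w ∈ closedWeightSpace (fun x : I => ρ x) g) :
    ρ y w ∈ closedWeightSpace (fun x : I => ρ x) g := by
  rw [mem_closedWeightSpace] at hw ⊢
  intro x
  have had : ∀ n : ℕ, ∃ x' : I, (LieAlgebra.ad ℂ (G →L[ℂ] G) (ρ y) ^ n) (ρ x) = ρ x' := fun n => by
    induction n with
    | zero => exact ⟨x, rfl⟩
    | succ n ih =>
      obtain ⟨x', hx'⟩ := ih
      refine ⟨⟨⁅y, (x' : L)⁆, I.lie_mem x'.2⟩, ?_⟩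
      rw [pow_succ', Module.End.mul_apply, hx', LieAlgebra.ad_apply, ← LieHom.map_lie]
  have h0 := ContinuousLinearMap.lie_apply_eq_zero_of_forall_ad_pow_apply_mem_span (ρ x) (ρ y) w
    fun n => by
      obtain ⟨x', hx'⟩ := had n
      rw [hx', hw x']
      exact Submodule.smul_mem _ _ (Submodule.mem_span_singleton_self w)
  rw [LieRing.of_associative_ring_bracket, sub_apply, mul_apply_eq_comp,
    mul_apply_eq_comp, hw x, map_smul, sub_eq_zero] at h0
  exact h0.symm

/-- **Lie's theorem** for Banach spaces: a finite-dimensional solvable Lie algebra of bounded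
operators has an approximate common eigenvector. -/
theorem LieAlgebra.exists_approximate_weight {F : Type*} [NormedAddCommGroup F] [NormedSpace ℂ F]
    [CompleteSpace F] [Nontrivial F] (L : Type*) [LieRing L] [LieAlgebra ℂ L]
    [FiniteDimensional ℂ L] [LieAlgebra.IsSolvable L] (ρ : L →ₗ⁅ℂ⁆ (F →L[ℂ] F)) :
    ∃ f : Module.Dual ℂ L, ∀ (s : Finset L) (ε : ℝ), 0 < ε →
      ∃ u : F, ∑ x ∈ s, ‖ρ x u - f x • u‖ < ε * ‖u‖ := by
  obtain hL | hL := subsingleton_or_nontrivial L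
  · refine ⟨0, fun s ε hε => ?_⟩
    obtain ⟨u, hu⟩ := exists_ne (0 : F)
    refine ⟨u, ?_⟩
    rw [Finset.sum_eq_zero fun x _ => by simp [Subsingleton.elim x 0]]
    exact mul_pos hε (norm_pos_iff.2 hu)
  -- Solvability makes `[L, L]` proper; the kernel of a nonzero functional vanishing on it is an
  -- ideal of codimension one.
  obtain ⟨θ, hθ0, hθ⟩ := Submodule.exists_le_ker_of_lt_top
    (LieAlgebra.derivedSeries ℂ L 1).toSubmodule
    (LieAlgebra.derivedSeries_lt_top_of_solvable ℂ L)
  have hθlie : ∀ x y : L, θ ⁅x, y⁆ = 0 := fun x y =>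
    hθ (LieSubmodule.lie_mem_lie (LieSubmodule.mem_top _) (LieSubmodule.mem_top _))
  let I : LieIdeal ℂ L := { LinearMap.ker θ with lie_mem := fun {x m} _ => hθlie x m }
  obtain ⟨y, hy⟩ : ∃ y, θ y = 1 := LinearMap.surjective hθ0 1
  have hfin : Module.finrank ℂ I < Module.finrank ℂ L :=
    Submodule.finrank_lt (s := LinearMap.ker θ)
      (lt_top_iff_ne_top.2 fun h => hθ0 (LinearMap.ker_eq_top.1 h)).ne
  obtain ⟨g, hg⟩ := LieAlgebra.exists_approximate_weight I (ρ.comp I.incl)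
  let T : I →ₗ[ℂ] F →L[ℂ] F :=
    (ρ.comp I.incl : I →ₗ[ℂ] F →L[ℂ] F) - g.smulRight (1 : F →L[ℂ] F)
  obtain ⟨u, hu1, hu⟩ := exists_unit_sequence_of_approximate_weight T hg
  obtain ⟨v, hv0, hv⟩ := SequenceQuotient.exists_ne_zero_of_tendsto hu1
  let ρ' : L →ₗ⁅ℂ⁆ (SequenceQuotient F →L[ℂ] SequenceQuotient F) :=
    (SequenceQuotient.mapAlgHom F : _ →ₗ⁅ℂ⁆ _).comp ρ
  have hρ' : ∀ x, ρ' x = SequenceQuotient.map (ρ x) := fun x => rfl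
  have hmap : ∀ (x : L) (c : ℂ) (w : SequenceQuotient F),
      SequenceQuotient.map (ρ x - c • (1 : F →L[ℂ] F)) w = ρ' x w - c • w := fun x c w => by
    induction w using Submodule.Quotient.induction_on
    rfl
  let W := closedWeightSpace (fun x : I => ρ' x) g
  have hvW : v ∈ W := mem_closedWeightSpace.2 fun x => by
    have := hv (T x) (hu x)
    rw [show T x = ρ x - g x • (1 : F →L[ℂ] F) from rfl, hmap, sub_eq_zero] at this
    exact this
  have : Nontrivial W := ⟨⟨v, hvW⟩, 0, fun h => hv0 (congrArg Subtype.val h)⟩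
  have : CompleteSpace W := (isClosed_closedWeightSpace _ _).completeSpace_coe
  let Y : W →L[ℂ] W := (ρ' y ∘L W.subtypeL).codRestrict W fun w =>
    apply_mem_closedWeightSpace I ρ' g y w.2
  obtain ⟨μ, hμ⟩ := Y.exists_approximate_eigenvalue
  let π : L →ₗ[ℂ] I := (LinearMap.id - θ.smulRight y).codRestrict (LinearMap.ker θ)
    fun x => by simp [hy]
  have hπ : ∀ x, x = (π x : L) + θ x • y := fun x => (sub_add_cancel x (θ x • y)).symm
  refine ⟨g ∘ₗ π + μ • θ, fun s ε hε => ?_⟩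
  set C : ℝ := ∑ x ∈ s, ‖θ x‖ with hC
  have hC0 : 0 ≤ C := Finset.sum_nonneg fun _ _ => norm_nonneg _
  -- The denominator `C + 1` also covers `C = 0` and keeps the final inequality strict.
  obtain ⟨w, hw⟩ := hμ (ε / (C + 1)) (by positivity)
  refine SequenceQuotient.exists_sum_norm_apply_lt s
    (fun x => ρ x - (g (π x) + μ * θ x) • (1 : F →L[ℂ] F)) hε (v := w) ?_
  have hterm : ∀ x ∈ s, ‖SequenceQuotient.map (ρ x - (g (π x) + μ * θ x) • (1 : F →L[ℂ] F)) w‖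
      = ‖θ x‖ * ‖Y w - μ • w‖ := fun x _ => by
    rw [hmap, ← norm_smul]
    have h1 : ρ' x = ρ' (π x) + θ x • ρ' y := by
      rw [← map_smul ρ', ← map_add ρ', ← hπ]
    have h2 : ρ' (π x) w = g (π x) • (w : SequenceQuotient F) := mem_closedWeightSpace.1 w.2 (π x)
    have h3 : ((Y w : W) : SequenceQuotient F) = ρ' y w := rfl
    change _ = ‖θ x • (((Y w : W) : SequenceQuotient F) - μ • (w : SequenceQuotient F))‖
    rw [h3, h1, add_apply, smul_apply, h2]
    congr 1
    module
  rw [Finset.sum_congr rfl hterm, ← Finset.sum_mul, ← hC]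
  have hw0 : 0 < ‖(w : SequenceQuotient F)‖ := by
    by_contra h0
    have : ‖w‖ = 0 := le_antisymm (not_lt.1 h0) (norm_nonneg _)
    rw [this, mul_zero] at hw
    exact hw.not_ge (norm_nonneg _)
  calc C * ‖Y w - μ • w‖ ≤ C * (ε / (C + 1) * ‖w‖) := by gcongr
    _ = C / (C + 1) * (ε * ‖w‖) := by ring
    _ < 1 * (ε * ‖w‖) := by
      refine mul_lt_mul_of_pos_right ?_ (mul_pos hε hw0)
      rw [div_lt_one (by positivity)]
      linarith
    _ = ε * ‖(w : SequenceQuotient F)‖ := by rw [one_mul]; rfl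
termination_by Module.finrank ℂ L

/-- With `T x = ρ x - f x`, the operator `⁅T x, T y⁆ - T ⁅x, y⁆` is the scalar `f ⁅x, y⁆`, yet it
sends the unit vectors `u n` to a null sequence. -/
theorem LieAlgebra.exists_character_approximate_eigenvectors {F : Type*} [NormedAddCommGroup F]
    [NormedSpace ℂ F] [CompleteSpace F] [Nontrivial F] {L : Type*} [LieRing L] [LieAlgebra ℂ L]
    [FiniteDimensional ℂ L] [LieAlgebra.IsSolvable L] (ρ : L →ₗ⁅ℂ⁆ (F →L[ℂ] F)) :
    ∃ f : Module.Dual ℂ L, (∀ x y : L, f ⁅x, y⁆ = 0) ∧ ∃ u : ℕ → F, (∀ n, ‖u n‖ = 1) ∧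
      ∀ x, Tendsto (fun n => (ρ x - f x • (1 : F →L[ℂ] F)) (u n)) atTop (𝓝 0) := by
  obtain ⟨f, hf⟩ := LieAlgebra.exists_approximate_weight L ρ
  let T : L →ₗ[ℂ] F →L[ℂ] F := (ρ : L →ₗ[ℂ] F →L[ℂ] F) - f.smulRight 1
  have hT : ∀ x φ, T x φ = ρ x φ - f x • φ := fun x φ => rfl
  obtain ⟨u, hu1, hu⟩ := exists_unit_sequence_of_approximate_weight T hf
  refine ⟨f, fun x y => ?_, u, hu1, hu⟩
  have h1 : ∀ n, T x (T y (u n)) - T y (T x (u n)) - T ⁅x, y⁆ (u n) = f ⁅x, y⁆ • u n := fun n => by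
    simp only [hT, map_sub, map_smul, LieHom.map_lie, LieRing.of_associative_ring_bracket,
      sub_apply, mul_apply_eq_comp]
    module
  have hlim : ∀ a b, Tendsto (fun n => T a (T b (u n))) atTop (𝓝 0) := fun a b => by
    simpa [Function.comp_def] using! ((T a).continuous.tendsto 0).comp (hu b)
  have h2 := (((hlim x y).sub (hlim y x)).sub (hu ⁅x, y⁆)).norm
  simp only [h1, norm_smul, hu1, mul_one, sub_zero, norm_zero] at h2
  exact norm_eq_zero.1 (tendsto_nhds_unique tendsto_const_nhds h2)

/-! ### Duality and homology in degree zero. -/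

/-- Operators acting on the right on `E` act on the left on the dual space of `E`. -/
noncomputable def dualAction (E : Type*) [NormedAddCommGroup E] [NormedSpace ℂ E] :
    (E →L[ℂ] E)ᵐᵒᵖ →ₐ[ℂ] (StrongDual ℂ E →L[ℂ] StrongDual ℂ E) :=
  AlgHom.ofLinearMap
    { toFun := fun S => (ContinuousLinearMap.compL ℂ E E ℂ).flip S.unop
      map_add' := by simp
      map_smul' := by simp }
    (by ext; rfl) (by intros; ext; rfl)

namespace SolvableSpectrum

variable {E : Type*} [NormedAddCommGroup E] [NormedSpace ℂ E] {L : Type*} [LieRing L]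
  [LieAlgebra ℂ L]

/-- The first differential has no bracket term, so under `E ⊗ ⋀⁰ L ≅ E` its range is spanned by the
`e(x - f x)`. -/
theorem eq_top_of_boundaries_zero_eq_top {ρ : L →ₗ⁅ℂ⁆ (E →L[ℂ] E)ᵐᵒᵖ} {f : Module.Dual ℂ L}
    (h : boundaries ρ f 0 = ⊤) {N : Submodule ℂ E}
    (hN : ∀ (x : L) (e : E), (ρ x).unop e - f x • e ∈ N) : N = ⊤ := by
  let ψ : E ⊗[ℂ] ⋀[ℂ]^0 L →ₗ[ℂ] E :=
    (TensorProduct.rid ℂ E).toLinearMap ∘ₗ (exteriorPower.zeroEquiv ℂ L).toLinearMap.lTensor E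
  have hψ : ∀ (e : E) (v : Fin 0 → L), ψ (e ⊗ₜ exteriorPower.ιMulti ℂ 0 v) = e := fun e v => by
    simp [ψ]
  have key : ∀ z, ψ (d ρ f 0 z) ∈ N := fun z => by
    induction z using TensorProduct.induction_on with
    | zero => simp
    | add a b ha hb => rw [map_add, map_add]; exact N.add_mem ha hb
    | tmul e w =>
      have hw : w ∈ Submodule.span ℂ (Set.range (exteriorPower.ιMulti ℂ 1 (M := L))) := by
        rw [exteriorPower.ιMulti_span]; trivial
      induction hw using Submodule.span_induction with
      | mem w hw =>
        obtain ⟨v, rfl⟩ := hw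
        rw [d_zero_tmul, hψ]
        exact hN _ _
      | zero => simp
      | add a b _ _ ha hb => rw [TensorProduct.tmul_add, map_add, map_add]; exact N.add_mem ha hb
      | smul c a _ ha => rw [TensorProduct.tmul_smul, map_smul, map_smul]; exact N.smul_mem c ha
  refine Submodule.eq_top_iff'.2 fun e => ?_
  obtain ⟨z, hz⟩ : e ⊗ₜ exteriorPower.ιMulti ℂ 0 (0 : Fin 0 → L) ∈ boundaries ρ f 0 :=
    h ▸ Submodule.mem_top
  simpa only [hz, hψ] using key z

theorem homologySpectrum_zero_nonempty [CompleteSpace E] [Nontrivial E]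
    [FiniteDimensional ℂ L] [LieAlgebra.IsSolvable L] (ρ : L →ₗ⁅ℂ⁆ (E →L[ℂ] E)ᵐᵒᵖ) :
    (homologySpectrum ρ 0).Nonempty := by
  classical
  let ρ' : L →ₗ⁅ℂ⁆ (StrongDual ℂ E →L[ℂ] StrongDual ℂ E) := (dualAction E : _ →ₗ⁅ℂ⁆ _).comp ρ
  obtain ⟨f, hf, u, hu1, hu⟩ := LieAlgebra.exists_character_approximate_eigenvectors ρ'
  refine ⟨f, hf, fun htop => ?_⟩
  let T : L → StrongDual ℂ E →L[ℂ] StrongDual ℂ E :=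
    fun x => ρ' x - f x • (1 : StrongDual ℂ E →L[ℂ] StrongDual ℂ E)
  have hT : ∀ x φ e, T x φ e = φ ((ρ x).unop e - f x • e) := fun x φ e => by
    rw [map_sub, map_smul]; rfl
  let b := Module.finBasis ℂ L
  let S : (Fin (Module.finrank ℂ L) → E) →L[ℂ] E :=
    ∑ i, ((ρ (b i)).unop - f (b i) • 1) ∘L ContinuousLinearMap.proj i
  have hS : ∀ a, S a = ∑ i, ((ρ (b i)).unop (a i) - f (b i) • a i) := fun a => by simp [S]
  have hmem : ∀ (x : L) (e : E), (ρ x).unop e - f x • e ∈ S.range := fun x e => by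
    have hx : (ρ x).unop e - f x • e = (act ρ f ∘ₗ TensorProduct.mk ℂ E L e) x := by simp [act]
    rw [hx, ← b.sum_repr x, map_sum]
    refine Submodule.sum_mem _ fun i _ => ?_
    rw [map_smul]
    refine Submodule.smul_mem _ _ ⟨Pi.single i e, ?_⟩
    change S _ = _
    rw [hS, Finset.sum_eq_single i (fun j _ hj => by simp [hj]) (by simp)]
    simp [act]
  have hsurj : Function.Surjective S :=
    LinearMap.range_eq_top.1 (eq_top_of_boundaries_zero_eq_top htop hmem)
  -- The open mapping theorem gives preimages with norm control; dually, `φ` is bounded by the `T (b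
  -- i) φ`, which fails along the unit vectors `u n`.
  obtain ⟨C, hC, hpre⟩ := S.exists_preimage_norm_le hsurj
  have hbound : ∀ φ : StrongDual ℂ E, ‖φ‖ ≤ C * ∑ i, ‖T (b i) φ‖ := fun φ => by
    refine φ.opNorm_le_bound
      (mul_nonneg hC.le (Finset.sum_nonneg fun _ _ => norm_nonneg _)) fun e => ?_
    obtain ⟨a, rfl, ha⟩ := hpre e
    have h1 : φ (S a) = ∑ i, T (b i) φ (a i) := by
      simp only [hS, map_sum, hT]
    rw [h1]
    calc ‖∑ i, T (b i) φ (a i)‖ ≤ ∑ i, ‖T (b i) φ‖ * (C * ‖S a‖) := by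
          refine norm_sum_le_of_le _ fun i _ => ((T (b i) φ).le_opNorm _).trans ?_
          gcongr
          exact (norm_le_pi_norm a i).trans ha
      _ = _ := by rw [← Finset.sum_mul]; ring
  have hlim : Tendsto (fun n => C * ∑ i, ‖T (b i) (u n)‖) atTop (𝓝 0) := by
    have := (tendsto_finsetSum Finset.univ fun i _ => (hu (b i)).norm).const_mul C
    rwa [Finset.sum_eq_zero fun _ _ => norm_zero, mul_zero] at this
  obtain ⟨n, hn⟩ := (hlim.eventually_lt_const one_pos).exists
  exact (hbound (u n)).not_gt (hu1 n ▸ hn)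

end SolvableSpectrum

theorem theorem4p8 {E : Type*} [NormedAddCommGroup E] [NormedSpace ℂ E] [CompleteSpace E]
    [Nontrivial E] (L : LieSubalgebra ℂ (E →L[ℂ] E)ᵐᵒᵖ) [FiniteDimensional ℂ L]
    [LieAlgebra.IsSolvable L] (k : ℕ) (hk : k ≤ Module.finrank ℂ L) :
    (SolvableSpectrum.sigmaDelta L.incl k).Nonempty := by
  obtain ⟨f, hf⟩ := SolvableSpectrum.homologySpectrum_zero_nonempty L.incl
  exact ⟨f, Set.mem_biUnion (Set.mem_Iic.2 k.zero_le) hf⟩
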